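/- All graphs are finite and simple. A graph $G$ is $\mathcal G$-free, for a family $\mathcal G$ of graphs, if no induced subgraph of $G$ is isomorphic to a member of $\mathcal G$. Let $\textsf{odd-holes}_7$ be the family of cycles $C_k$ with $k\ge 7$ odd, and let $\mathcal F$ be the family of the following sixteen graphs, given on the vertex set $\{0,1,\dots,r-1\}$ by their edges. On five vertices: - $\textsf{bull}$: $04,13,23,24,34$; - $\textsf{dart}$: $04,13,14,23,24,34$; - $\textsf{house}$: $01,04,13,23,24,34$; - $\textsf{gem}$: $03,04,12,14,23,24,34$; - $\textsf{full-house}$: $03,04,12,13,14,23,24,34$. On six vertices: - $\textsf{G}_{6,5}$: $04,15,23,25,35,45$; - $\textsf{5-pan}$: $05,12,14,23,35,45$; - $\textsf{G}_{6,7}$: $04,12,15,25,34,35$; - $\textsf{G}_{6,8}$: $05,14,15,23,25,35,45$; - $\textsf{G}_{6,9}$: $05,15,23,24,34,35,45$; - $\textsf{G}_{6,10}$: $01,05,14,24,25,34,35$; - $\textsf{co-twin-house}$: $05,14,23,24,25,34,35$; - $\textsf{G}_{6,12}$: $05,14,15,23,24,25,34,35$; - $\textsf{co-twin-}C_5$: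 $01,05,14,23,24,25,34,35$; - $\textsf{G}_{6,14}=K_{2,2,1,1}$: $02,03,04,05,12,13,14,15,24,25,34,35,45$. On seven vertices: - $\textsf{G}_{6,15}$: $01,06,16,24,25,34,35,46,56$. For an integer vector $\mathbf a\in\mathbb Z^k$, let $P_k^{\mathbf a}$ be the graph obtained from the path $P_k$ by replacing its $i$-th vertex by a clique of size $a_i+1$ if $a_i>0$, by an independent set of size $-a_i+1$ if $a_i<0$, and keeping it if $a_i=0$; every vertex replacing the $i$-th vertex is adjacent to every vertex replacing the $j$-th vertex if $|i-j|=1$, and to none of them if $|i-j|\ge 2$. **Theorem.** Let $G$ be a connected $\{\mathcal F,\textsf{odd-holes}_7\}$-free graph with $n$ vertices. Then $G$ is (up to isomorphism) one of the following: 1. $C_5$; 2. a bipartite graph; 3. a complete tripartite graph $K_{a,b,c}$ with $a,b,c\ge 1$; 4. a complete multipartite graph $K_{n-p+1,1,\dots,1}$ with $p$ parts, for some $1\le p\le n$; 5. a connected induced subgraph of $P_5^{(-m_1,n_1,-m_2,n_2,-m_3)}$ for some integers $m_1,n_1,m_2,n_2,m_3\ge 0$; 6. a connected induced subgraph of $P_4^{(n_1,-m_1,-m_2,n_2)}$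 for some integers $n_1,m_1,m_2,n_2\ge 0$. -/

import Mathlib

open scoped SimpleGraph

/-- The simple graph on `Fin n` whose edges are the (unordered) pairs listed in `l`. -/
def ofEdges (n : ℕ) (l : List (Fin n × Fin n)) : SimpleGraph (Fin n) where
  Adj a b := a ≠ b ∧ ((a, b) ∈ l ∨ (b, a) ∈ l)
  symm := ⟨fun _ _ h => ⟨h.1.symm, h.2.symm⟩⟩
  loopless := ⟨fun _ h => h.1 rfl⟩

instance (n : ℕ) (l : List (Fin n × Fin n)) : DecidableRel (ofEdges n l).Adj :=
  fun a b => inferInstanceAs (Decidable (a ≠ b ∧ ((a, b) ∈ l ∨ (b, a) ∈ l)))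

/-- The bull: a triangle with pendant edges at two of its vertices. -/
def bull : SimpleGraph (Fin 5) :=
  ofEdges 5 [(0, 4), (1, 3), (2, 3), (2, 4), (3, 4)]

/-- The dart: a diamond with a pendant edge at a vertex of degree three. -/
def dart : SimpleGraph (Fin 5) :=
  ofEdges 5 [(0, 4), (1, 3), (1, 4), (2, 3), (2, 4), (3, 4)]

/-- The house: a 4-cycle and a triangle sharing an edge. -/
def house : SimpleGraph (Fin 5) :=
  ofEdges 5 [(0, 1), (0, 4), (1, 3), (2, 3), (2, 4), (3, 4)]

/-- The gem: a path on four vertices and a vertex adjacent to all of them. -/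
def gem : SimpleGraph (Fin 5) :=
  ofEdges 5 [(0, 3), (0, 4), (1, 2), (1, 4), (2, 3), (2, 4), (3, 4)]

/-- The full house: a complete graph on four vertices and a triangle sharing an edge. -/
def fullHouse : SimpleGraph (Fin 5) :=
  ofEdges 5 [(0, 3), (0, 4), (1, 2), (1, 3), (1, 4), (2, 3), (2, 4), (3, 4)]

/-- The graph `G_{6,5}`. -/
def graph6_5 : SimpleGraph (Fin 6) :=
  ofEdges 6 [(0, 4), (1, 5), (2, 3), (2, 5), (3, 5), (4, 5)]

/-- The 5-pan: a 5-cycle with a pendant edge. -/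
def fivePan : SimpleGraph (Fin 6) :=
  ofEdges 6 [(0, 5), (1, 2), (1, 4), (2, 3), (3, 5), (4, 5)]

/-- The graph `G_{6,7}`. -/
def graph6_7 : SimpleGraph (Fin 6) :=
  ofEdges 6 [(0, 4), (1, 2), (1, 5), (2, 5), (3, 4), (3, 5)]

/-- The graph `G_{6,8}`. -/
def graph6_8 : SimpleGraph (Fin 6) :=
  ofEdges 6 [(0, 5), (1, 4), (1, 5), (2, 3), (2, 5), (3, 5), (4, 5)]

/-- The graph `G_{6,9}`. -/
def graph6_9 : SimpleGraph (Fin 6) :=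
  ofEdges 6 [(0, 5), (1, 5), (2, 3), (2, 4), (3, 4), (3, 5), (4, 5)]

/-- The graph `G_{6,10}`. -/
def graph6_10 : SimpleGraph (Fin 6) :=
  ofEdges 6 [(0, 1), (0, 5), (1, 4), (2, 4), (2, 5), (3, 4), (3, 5)]

/-- The co-twin-house. -/
def coTwinHouse : SimpleGraph (Fin 6) :=
  ofEdges 6 [(0, 5), (1, 4), (2, 3), (2, 4), (2, 5), (3, 4), (3, 5)]

/-- The graph `G_{6,12}`. -/
def graph6_12 : SimpleGraph (Fin 6) :=
  ofEdges 6 [(0, 5), (1, 4), (1, 5), (2, 3), (2, 4), (2, 5), (3, 4), (3, 5)]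

/-- The co-twin-`C_5`: a 5-cycle with one vertex replaced by two adjacent twins. -/
def coTwinC5 : SimpleGraph (Fin 6) :=
  ofEdges 6 [(0, 1), (0, 5), (1, 4), (2, 3), (2, 4), (2, 5), (3, 4), (3, 5)]

/-- The graph `G_{6,14}`, that is, `K_{2,2,1,1}`. -/
def graph6_14 : SimpleGraph (Fin 6) :=
  ofEdges 6 [(0, 2), (0, 3), (0, 4), (0, 5), (1, 2), (1, 3), (1, 4), (1, 5), (2, 4), (2, 5),
    (3, 4), (3, 5), (4, 5)]

/-- The graph `G_{6,15}` (it has seven vertices): a triangle and a 4-cycle sharing a vertex. -/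
def graph6_15 : SimpleGraph (Fin 7) :=
  ofEdges 7 [(0, 1), (0, 6), (1, 6), (2, 4), (2, 5), (3, 4), (3, 5), (4, 6), (5, 6)]

/-- The family `F` of sixteen forbidden graphs. -/
def familyF : List (Σ n : ℕ, SimpleGraph (Fin n)) :=
  [⟨5, bull⟩, ⟨5, dart⟩, ⟨5, house⟩, ⟨5, gem⟩, ⟨5, fullHouse⟩, ⟨6, graph6_5⟩, ⟨6, fivePan⟩,
    ⟨6, graph6_7⟩, ⟨6, graph6_8⟩, ⟨6, graph6_9⟩, ⟨6, graph6_10⟩, ⟨6, coTwinHouse⟩,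
    ⟨6, graph6_12⟩, ⟨6, coTwinC5⟩, ⟨6, graph6_14⟩, ⟨7, graph6_15⟩]

/-- `G` is `{F, odd-holes₇}`-free: no induced subgraph of `G` is isomorphic to a member of `F`
or to a cycle of odd length at least seven. -/
def IsFOddHolesFree {V : Type*} (G : SimpleGraph V) : Prop :=
  (∀ H ∈ familyF, ¬ H.2 ⊴ G) ∧ ∀ k : ℕ, Odd k → 7 ≤ k → ¬ SimpleGraph.cycleGraph k ⊴ G

/-- The graph `P_k^a` for an integer vector `a`: the `i`-th vertex of the path `P_k` is replaced
by `|a i| + 1` vertices, which form a clique if `a i > 0` and an independent set if `a i < 0`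
(a single vertex if `a i = 0`); vertices in different classes are adjacent exactly when the
classes are consecutive on the path. -/
def pathBlowup {k : ℕ} (a : Fin k → ℤ) : SimpleGraph (Σ i : Fin k, Fin ((a i).natAbs + 1)) where
  Adj x y := (SimpleGraph.pathGraph k).Adj x.1 y.1 ∨ (x.1 = y.1 ∧ 0 < a x.1 ∧ x ≠ y)
  symm := ⟨by
    rintro x y (h | ⟨h, ha, hne⟩)
    · exact Or.inl h.symm
    · exact Or.inr ⟨h.symm, h ▸ ha, hne.symm⟩⟩
  loopless := ⟨by
    rintro x (h | ⟨-, -, hne⟩)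
    · exact (SimpleGraph.pathGraph k).loopless.irrefl _ h
    · exact hne rfl⟩

/-- The complete multipartite graph `K_{s 0, …, s (p - 1)}` with `p` parts. -/
def completeMultipartiteOfSizes {p : ℕ} (s : Fin p → ℕ) : SimpleGraph (Σ i : Fin p, Fin (s i)) :=
  SimpleGraph.completeMultipartiteGraph fun i => Fin (s i)

/-! A shortest odd closed walk in a non-bipartite graph traces an induced odd cycle, here of length
3 or 5, since longer ones are forbidden. No vertex can attach to an induced 5-cycle, so by
connectedness a 5-cycle is the whole graph.

Suppose there is a triangle. If no paw (triangle with a pendant edge) is induced, connectedness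
makes the graph complete multipartite, and excluding `K_{2,2,1,1}` leaves either three parts or at
most one part that is not a singleton.

If a paw is induced, with triangle `a b c` and pendant edge `c d`, every other vertex is adjacent to
it in one of six ways, according to its neighbours in the paw: `ab`, `abc`, `abd`, `c`, `cd`, `d`.
Adjacency between these kinds is forced, except inside kind `d`, which is a clique or an independent
set. The consecutive classes are (`ab`), (`a`, `b`, `abc`), (`c`, `abd`), (`d`, `cd`), (`d`-kind)
for the blow-up of `P_5`, and (`a`, `b`, `abc`), (`c`, `abd`), (`d`, `c`-kind), (`d`-kind) for that
of `P_4`. Kind `c` excludes kinds `ab` and `cd`, so one of the two shapes always fits. -/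

namespace IsFOddHolesFree

variable {V : Type*} {G : SimpleGraph V}

/-! ### Forbidden graphs as adjacency patterns -/

/-- A copy of a member of the family `F` inside an `F`-free graph, given by its vertices. -/
theorem false_of_pattern (hG : IsFOddHolesFree G) {k : ℕ} {H : SimpleGraph (Fin k)}
    (hH : ⟨k, H⟩ ∈ familyF) (p : Fin k → V)
    (hadj : ∀ i j, i < j → (G.Adj (p i) (p j) ↔ H.Adj i j))
    (T : List (Fin k × Fin k))
    (hT : ∀ i j, i < j → (∀ k, H.Adj i k ↔ H.Adj j k) → (i, j) ∈ T)
    (hne : ∀ e ∈ T, p e.1 ≠ p e.2) : False := by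
  have hmap : ∀ i j, G.Adj (p i) (p j) ↔ H.Adj i j := by
    intro i j
    rcases lt_trichotomy i j with h | rfl | h
    · exact hadj i j h
    · simp
    · rw [G.adj_comm, H.adj_comm, hadj j i h]
  refine hG.1 _ hH ⟨⟨⟨p, fun i j hij => ?_⟩, fun {i j} => hmap i j⟩⟩
  -- Vertices with the same image have the same neighbours in `H`, so only the twin pairs listed in
  -- `T` need their distinctness assumed.
  have htwin : ∀ k, H.Adj i k ↔ H.Adj j k := fun k => by rw [← hmap, ← hmap, hij]
  by_contra h
  rcases lt_or_gt_of_ne h with h | h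
  · exact hne _ (hT i j h htwin) hij
  · exact hne _ (hT j i h fun k => (htwin k).symm) hij.symm

theorem not_bull (hG : IsFOddHolesFree G) (u v w x y : V) :
    ¬(¬G.Adj u v ∧ ¬G.Adj u w ∧ ¬G.Adj u x ∧ G.Adj u y ∧ ¬G.Adj v w ∧ G.Adj v x ∧ ¬G.Adj v y
      ∧ G.Adj w x ∧ G.Adj w y ∧ G.Adj x y) := by
  intro h
  refine hG.false_of_pattern (H := bull) (by simp [familyF]) ![u, v, w, x, y] ?_
    [] (by unfold bull; decide) (by simp)
  simp [Fin.forall_fin_succ, bull, ofEdges, h]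

theorem not_dart (hG : IsFOddHolesFree G) (u v w x y : V) :
    ¬(v ≠ w ∧ ¬G.Adj u v ∧ ¬G.Adj u w ∧ ¬G.Adj u x ∧ G.Adj u y ∧ ¬G.Adj v w ∧ G.Adj v x
      ∧ G.Adj v y ∧ G.Adj w x ∧ G.Adj w y ∧ G.Adj x y) := by
  intro h
  refine hG.false_of_pattern (H := dart) (by simp [familyF]) ![u, v, w, x, y] ?_
    [(1, 2)] (by unfold dart; decide) (by simpa using h.1)
  simp [Fin.forall_fin_succ, dart, ofEdges, h]

theorem not_house (hG : IsFOddHolesFree G) (u v w x y : V) :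
    ¬(G.Adj u v ∧ ¬G.Adj u w ∧ ¬G.Adj u x ∧ G.Adj u y ∧ ¬G.Adj v w ∧ G.Adj v x ∧ ¬G.Adj v y
      ∧ G.Adj w x ∧ G.Adj w y ∧ G.Adj x y) := by
  intro h
  refine hG.false_of_pattern (H := house) (by simp [familyF]) ![u, v, w, x, y] ?_
    [] (by unfold house; decide) (by simp)
  simp [Fin.forall_fin_succ, house, ofEdges, h]

theorem not_gem (hG : IsFOddHolesFree G) (u v w x y : V) :
    ¬(¬G.Adj u v ∧ ¬G.Adj u w ∧ G.Adj u x ∧ G.Adj u y ∧ G.Adj v w ∧ ¬G.Adj v x ∧ G.Adj v y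
      ∧ G.Adj w x ∧ G.Adj w y ∧ G.Adj x y) := by
  intro h
  refine hG.false_of_pattern (H := gem) (by simp [familyF]) ![u, v, w, x, y] ?_
    [] (by unfold gem; decide) (by simp)
  simp [Fin.forall_fin_succ, gem, ofEdges, h]

theorem not_fullHouse (hG : IsFOddHolesFree G) (u v w x y : V) :
    ¬(¬G.Adj u v ∧ ¬G.Adj u w ∧ G.Adj u x ∧ G.Adj u y ∧ G.Adj v w ∧ G.Adj v x ∧ G.Adj v y
      ∧ G.Adj w x ∧ G.Adj w y ∧ G.Adj x y) := by
  intro h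
  refine hG.false_of_pattern (H := fullHouse) (by simp [familyF]) ![u, v, w, x, y] ?_
    [] (by unfold fullHouse; decide) (by simp)
  simp [Fin.forall_fin_succ, fullHouse, ofEdges, h]

theorem not_graph6_5 (hG : IsFOddHolesFree G) (u v w x y z : V) :
    ¬(¬G.Adj u v ∧ ¬G.Adj u w ∧ ¬G.Adj u x ∧ G.Adj u y ∧ ¬G.Adj u z ∧ ¬G.Adj v w ∧ ¬G.Adj v x
      ∧ ¬G.Adj v y ∧ G.Adj v z ∧ G.Adj w x ∧ ¬G.Adj w y ∧ G.Adj w z ∧ ¬G.Adj x y ∧ G.Adj x z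
      ∧ G.Adj y z) := by
  intro h
  refine hG.false_of_pattern (H := graph6_5) (by simp [familyF]) ![u, v, w, x, y, z] ?_
    [] (by unfold graph6_5; decide) (by simp)
  simp [Fin.forall_fin_succ, graph6_5, ofEdges, h]

theorem not_fivePan (hG : IsFOddHolesFree G) (u v w x y z : V) :
    ¬(¬G.Adj u v ∧ ¬G.Adj u w ∧ ¬G.Adj u x ∧ ¬G.Adj u y ∧ G.Adj u z ∧ G.Adj v w ∧ ¬G.Adj v x
      ∧ G.Adj v y ∧ ¬G.Adj v z ∧ G.Adj w x ∧ ¬G.Adj w y ∧ ¬G.Adj w z ∧ ¬G.Adj x y ∧ G.Adj x z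
      ∧ G.Adj y z) := by
  intro h
  refine hG.false_of_pattern (H := fivePan) (by simp [familyF]) ![u, v, w, x, y, z] ?_
    [] (by unfold fivePan; decide) (by simp)
  simp [Fin.forall_fin_succ, fivePan, ofEdges, h]

theorem not_graph6_7 (hG : IsFOddHolesFree G) (u v w x y z : V) :
    ¬(¬G.Adj u v ∧ ¬G.Adj u w ∧ ¬G.Adj u x ∧ G.Adj u y ∧ ¬G.Adj u z ∧ G.Adj v w ∧ ¬G.Adj v x
      ∧ ¬G.Adj v y ∧ G.Adj v z ∧ ¬G.Adj w x ∧ ¬G.Adj w y ∧ G.Adj w z ∧ G.Adj x y ∧ G.Adj x z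
      ∧ ¬G.Adj y z) := by
  intro h
  refine hG.false_of_pattern (H := graph6_7) (by simp [familyF]) ![u, v, w, x, y, z] ?_
    [] (by unfold graph6_7; decide) (by simp)
  simp [Fin.forall_fin_succ, graph6_7, ofEdges, h]

theorem not_graph6_8 (hG : IsFOddHolesFree G) (u v w x y z : V) :
    ¬(¬G.Adj u v ∧ ¬G.Adj u w ∧ ¬G.Adj u x ∧ ¬G.Adj u y ∧ G.Adj u z ∧ ¬G.Adj v w ∧ ¬G.Adj v x
      ∧ G.Adj v y ∧ G.Adj v z ∧ G.Adj w x ∧ ¬G.Adj w y ∧ G.Adj w z ∧ ¬G.Adj x y ∧ G.Adj x z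
      ∧ G.Adj y z) := by
  intro h
  refine hG.false_of_pattern (H := graph6_8) (by simp [familyF]) ![u, v, w, x, y, z] ?_
    [] (by unfold graph6_8; decide) (by simp)
  simp [Fin.forall_fin_succ, graph6_8, ofEdges, h]

theorem not_graph6_9 (hG : IsFOddHolesFree G) (u v w x y z : V) :
    ¬(u ≠ v ∧ ¬G.Adj u v ∧ ¬G.Adj u w ∧ ¬G.Adj u x ∧ ¬G.Adj u y ∧ G.Adj u z ∧ ¬G.Adj v w
      ∧ ¬G.Adj v x ∧ ¬G.Adj v y ∧ G.Adj v z ∧ G.Adj w x ∧ G.Adj w y ∧ ¬G.Adj w z ∧ G.Adj x y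
      ∧ G.Adj x z ∧ G.Adj y z) := by
  intro h
  refine hG.false_of_pattern (H := graph6_9) (by simp [familyF]) ![u, v, w, x, y, z] ?_
    [(0, 1)] (by unfold graph6_9; decide) (by simpa using h.1)
  simp [Fin.forall_fin_succ, graph6_9, ofEdges, h]

theorem not_graph6_10 (hG : IsFOddHolesFree G) (u v w x y z : V) :
    ¬(w ≠ x ∧ G.Adj u v ∧ ¬G.Adj u w ∧ ¬G.Adj u x ∧ ¬G.Adj u y ∧ G.Adj u z ∧ ¬G.Adj v w
      ∧ ¬G.Adj v x ∧ G.Adj v y ∧ ¬G.Adj v z ∧ ¬G.Adj w x ∧ G.Adj w y ∧ G.Adj w z ∧ G.Adj x y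
      ∧ G.Adj x z ∧ ¬G.Adj y z) := by
  intro h
  refine hG.false_of_pattern (H := graph6_10) (by simp [familyF]) ![u, v, w, x, y, z] ?_
    [(2, 3)] (by unfold graph6_10; decide) (by simpa using h.1)
  simp [Fin.forall_fin_succ, graph6_10, ofEdges, h]

theorem not_coTwinHouse (hG : IsFOddHolesFree G) (u v w x y z : V) :
    ¬(¬G.Adj u v ∧ ¬G.Adj u w ∧ ¬G.Adj u x ∧ ¬G.Adj u y ∧ G.Adj u z ∧ ¬G.Adj v w ∧ ¬G.Adj v x
      ∧ G.Adj v y ∧ ¬G.Adj v z ∧ G.Adj w x ∧ G.Adj w y ∧ G.Adj w z ∧ G.Adj x y ∧ G.Adj x z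
      ∧ ¬G.Adj y z) := by
  intro h
  refine hG.false_of_pattern (H := coTwinHouse) (by simp [familyF]) ![u, v, w, x, y, z] ?_
    [] (by unfold coTwinHouse; decide) (by simp)
  simp [Fin.forall_fin_succ, coTwinHouse, ofEdges, h]

theorem not_graph6_12 (hG : IsFOddHolesFree G) (u v w x y z : V) :
    ¬(¬G.Adj u v ∧ ¬G.Adj u w ∧ ¬G.Adj u x ∧ ¬G.Adj u y ∧ G.Adj u z ∧ ¬G.Adj v w ∧ ¬G.Adj v x
      ∧ G.Adj v y ∧ G.Adj v z ∧ G.Adj w x ∧ G.Adj w y ∧ G.Adj w z ∧ G.Adj x y ∧ G.Adj x z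
      ∧ ¬G.Adj y z) := by
  intro h
  refine hG.false_of_pattern (H := graph6_12) (by simp [familyF]) ![u, v, w, x, y, z] ?_
    [] (by unfold graph6_12; decide) (by simp)
  simp [Fin.forall_fin_succ, graph6_12, ofEdges, h]

theorem not_coTwinC5 (hG : IsFOddHolesFree G) (u v w x y z : V) :
    ¬(G.Adj u v ∧ ¬G.Adj u w ∧ ¬G.Adj u x ∧ ¬G.Adj u y ∧ G.Adj u z ∧ ¬G.Adj v w ∧ ¬G.Adj v x
      ∧ G.Adj v y ∧ ¬G.Adj v z ∧ G.Adj w x ∧ G.Adj w y ∧ G.Adj w z ∧ G.Adj x y ∧ G.Adj x z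
      ∧ ¬G.Adj y z) := by
  intro h
  refine hG.false_of_pattern (H := coTwinC5) (by simp [familyF]) ![u, v, w, x, y, z] ?_
    [] (by unfold coTwinC5; decide) (by simp)
  simp [Fin.forall_fin_succ, coTwinC5, ofEdges, h]

theorem not_graph6_14 (hG : IsFOddHolesFree G) (u v w x y z : V) :
    ¬(u ≠ v ∧ w ≠ x ∧ ¬G.Adj u v ∧ G.Adj u w ∧ G.Adj u x ∧ G.Adj u y ∧ G.Adj u z ∧ G.Adj v w
      ∧ G.Adj v x ∧ G.Adj v y ∧ G.Adj v z ∧ ¬G.Adj w x ∧ G.Adj w y ∧ G.Adj w z ∧ G.Adj x y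
      ∧ G.Adj x z ∧ G.Adj y z) := by
  intro h
  refine hG.false_of_pattern (H := graph6_14) (by simp [familyF]) ![u, v, w, x, y, z] ?_
    [(0, 1), (2, 3)] (by unfold graph6_14; decide) (by simp [h])
  simp [Fin.forall_fin_succ, graph6_14, ofEdges, h]

theorem not_graph6_15 (hG : IsFOddHolesFree G) (u v w x y z t : V) :
    ¬(w ≠ x ∧ y ≠ z ∧ G.Adj u v ∧ ¬G.Adj u w ∧ ¬G.Adj u x ∧ ¬G.Adj u y ∧ ¬G.Adj u z
      ∧ G.Adj u t ∧ ¬G.Adj v w ∧ ¬G.Adj v x ∧ ¬G.Adj v y ∧ ¬G.Adj v z ∧ G.Adj v t ∧ ¬G.Adj w x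
      ∧ G.Adj w y ∧ G.Adj w z ∧ ¬G.Adj w t ∧ G.Adj x y ∧ G.Adj x z ∧ ¬G.Adj x t ∧ ¬G.Adj y z
      ∧ G.Adj y t ∧ G.Adj z t) := by
  intro h
  refine hG.false_of_pattern (H := graph6_15) (by simp [familyF]) ![u, v, w, x, y, z, t] ?_
    [(2, 3), (4, 5)] (by unfold graph6_15; decide) (by simp [h])
  simp [Fin.forall_fin_succ, graph6_15, ofEdges, h]

end IsFOddHolesFree

/-! ### Neighbours of an induced paw -/

section Paw

variable {V : Type*} {G : SimpleGraph V}

/-- The vertices `a`, `b`, `c` span a triangle of `G` and `d` is adjacent to `c` only. -/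
structure IsPaw (G : SimpleGraph V) (a b c d : V) : Prop where
  ab : G.Adj a b
  ac : G.Adj a c
  bc : G.Adj b c
  cd : G.Adj c d
  not_ad : ¬G.Adj a d
  not_bd : ¬G.Adj b d

/-- The vertex `x` is distinct from `a`, `b`, `c`, `d`, and `p`, `q`, `r`, `s` tell to which of
these vertices it is adjacent. -/
def Sees (G : SimpleGraph V) (a b c d x : V) (p q r s : Bool) : Prop :=
  (x ≠ a ∧ x ≠ b ∧ x ≠ c ∧ x ≠ d) ∧
    (G.Adj a x ↔ p) ∧ (G.Adj b x ↔ q) ∧ (G.Adj c x ↔ r) ∧ (G.Adj d x ↔ s)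

/-- The six ways in which a vertex outside a paw of an `F`-free graph can be adjacent to it. -/
def SeesPaw (G : SimpleGraph V) (a b c d x : V) : Prop :=
  Sees G a b c d x true true false false ∨ Sees G a b c d x true true true false ∨
    Sees G a b c d x true true false true ∨ Sees G a b c d x false false true false ∨
    Sees G a b c d x false false true true ∨ Sees G a b c d x false false false true

namespace IsPaw

variable {a b c d : V}

local notation "S" => Sees G a b c d

/-- Each of the nine other nonempty neighbourhoods gives a forbidden graph on the five vertices, one
per pattern below. -/
theorem sees_of_adj (hP : IsPaw G a b c d) (hG : IsFOddHolesFree G) {x : V}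
    (hne : x ≠ a ∧ x ≠ b ∧ x ≠ c ∧ x ≠ d)
    (hx : G.Adj a x ∨ G.Adj b x ∨ G.Adj c x ∨ G.Adj d x) :
    SeesPaw G a b c d x := by
  obtain ⟨hab, hac, hbc, hcd, had, hbd⟩ := hP
  have h1 := hG.not_bull d x b a c
  have h2 := hG.not_bull d x a b c
  have h3 := hG.not_dart d b x a c
  have h4 := hG.not_dart d a x b c
  have h5 := hG.not_house d x b a c
  have h6 := hG.not_house d x a b c
  have h7 := hG.not_gem b d x a c
  have h8 := hG.not_gem a d x b c
  have h9 := hG.not_fullHouse d a b c x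
  simp only [SeesPaw, Sees]
  by_cases ha : G.Adj a x <;> by_cases hb : G.Adj b x <;> by_cases hc : G.Adj c x <;>
    by_cases hd : G.Adj d x <;> simp_all [G.adj_comm]

/-- This rules out vertices at distance two from the paw; each of the six kinds of `y` has its own
forbidden graph. -/
theorem not_adj_of_sees_none (hP : IsPaw G a b c d) (hG : IsFOddHolesFree G) {x y : V}
    (hx : S x false false false false)
    (hy : SeesPaw G a b c d y) :
    ¬G.Adj x y := by
  intro hxy
  obtain ⟨hab, hac, hbc, hcd, had, hbd⟩ := hP
  have h1 := hG.not_coTwinHouse d x a b y c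
  have h2 := hG.not_graph6_5 x d a b y c
  have h3 := hG.not_bull d x a y c
  have h4 := hG.not_graph6_7 x a b d y c
  have h5 := hG.not_graph6_12 x d a b c y
  have h6 := hG.not_bull a x d y c
  simp only [SeesPaw, Sees] at hx hy
  rcases hy with hy | hy | hy | hy | hy | hy <;> simp_all [G.adj_comm]

/-- The wrong adjacency always completes a forbidden graph. For kind `c` both are wrong: `graph6_9`
arises without the edge, `graph6_12` with it. -/
theorem of_sees_ab (hP : IsPaw G a b c d) (hG : IsFOddHolesFree G) {x y : V} (hxy : x ≠ y)
    (hx : S x true true false false) :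
    (S y true true false false → ¬G.Adj x y) ∧
    (S y true true true false → G.Adj x y) ∧
    (S y true true false true → ¬G.Adj x y) ∧
    (S y false false true true → ¬G.Adj x y) ∧
    (S y false false false true → ¬G.Adj x y) ∧
    (S y false false true false → False) := by
  obtain ⟨hab, hac, hbc, hcd, had, hbd⟩ := hP
  have h1 := hG.not_fullHouse c x y a b
  have h2 := hG.not_bull d x y a c
  have h3 := hG.not_house c d x y a
  have h4 := hG.not_house a x d y c
  have h5 := hG.not_coTwinC5 d y a b x c
  have h6 := hG.not_graph6_9 d y x a b c
  have h7 := hG.not_graph6_12 d y a b x c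
  simp only [Sees] at hx ⊢
  refine ⟨fun hy => ?_, fun hy => ?_, fun hy => ?_, fun hy => ?_, fun hy => ?_, fun hy => ?_⟩ <;> by_cases h : G.Adj x y <;> simp_all [G.adj_comm]

theorem of_sees_abc (hP : IsPaw G a b c d) (hG : IsFOddHolesFree G) {x y : V} (hxy : x ≠ y)
    (hx : S x true true true false) :
    (S y true true true false → G.Adj x y) ∧
    (S y true true false true → G.Adj x y) ∧
    (S y false false true true → ¬G.Adj x y) ∧
    (S y false false false true → ¬G.Adj x y) ∧
    (S y false false true false → ¬G.Adj x y) := by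
  obtain ⟨hab, hac, hbc, hcd, had, hbd⟩ := hP
  have h1 := hG.not_dart d x y a c
  have h2 := hG.not_house d y x a c
  have h3 := hG.not_gem a d y x c
  have h4 := hG.not_house d y a x c
  have h5 := hG.not_dart d a y x c
  simp only [Sees] at hx ⊢
  refine ⟨fun hy => ?_, fun hy => ?_, fun hy => ?_, fun hy => ?_, fun hy => ?_⟩ <;> by_cases h : G.Adj x y <;> simp_all [G.adj_comm]

theorem of_sees_abd (hP : IsPaw G a b c d) (hG : IsFOddHolesFree G) {x y : V} (hxy : x ≠ y)
    (hx : S x true true false true) :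
    (S y true true false true → ¬G.Adj x y) ∧
    (S y false false true true → G.Adj x y) ∧
    (S y false false false true → ¬G.Adj x y) ∧
    (S y false false true false → G.Adj x y) := by
  obtain ⟨hab, hac, hbc, hcd, had, hbd⟩ := hP
  have h1 := hG.not_fullHouse c x y a b
  have h2 := hG.not_house a x y d c
  have h3 := hG.not_house a c y d x
  have h4 := hG.not_graph6_12 y d a b x c
  simp only [Sees] at hx ⊢
  refine ⟨fun hy => ?_, fun hy => ?_, fun hy => ?_, fun hy => ?_⟩ <;> by_cases h : G.Adj x y <;> simp_all [G.adj_comm]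

/-- Kind `cd` is incompatible with kind `c`: a dart arises if `x` and `y` are adjacent, `graph6_8`
otherwise. -/
theorem of_sees_c (hP : IsPaw G a b c d) (hG : IsFOddHolesFree G) {x y : V} (hxy : x ≠ y)
    (hx : S x false false true false) :
    (S y false false true false → ¬G.Adj x y) ∧
    (S y false false true true → False) ∧
    (S y false false false true → G.Adj x y) := by
  obtain ⟨hab, hac, hbc, hcd, had, hbd⟩ := hP
  have h1 := hG.not_graph6_8 d a x y b c
  have h2 := hG.not_graph6_8 x a d y b c
  have h3 := hG.not_dart a d x y c
  have h4 := hG.not_graph6_5 y x a b d c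
  simp only [Sees] at hx ⊢
  refine ⟨fun hy => ?_, fun hy => ?_, fun hy => ?_⟩ <;> by_cases h : G.Adj x y <;> simp_all [G.adj_comm]

theorem of_sees_cd (hP : IsPaw G a b c d) (hG : IsFOddHolesFree G) {x y : V} (hxy : x ≠ y)
    (hx : S x false false true true) :
    (S y false false true true → G.Adj x y) ∧
    (S y false false false true → G.Adj x y) := by
  obtain ⟨hab, hac, hbc, hcd, had, hbd⟩ := hP
  have h1 := hG.not_dart a x y d c
  have h2 := hG.not_bull a y x d c
  simp only [Sees] at hx ⊢
  refine ⟨fun hy => ?_, fun hy => ?_⟩ <;> by_cases h : G.Adj x y <;> simp_all [G.adj_comm]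

/-- Otherwise the triangle `y z d` with the path `d c a x` attached is `graph6_7`. -/
theorem not_adj_of_sees_ab_d_d (hP : IsPaw G a b c d) (hG : IsFOddHolesFree G) {x y z : V}
    (hx : S x true true false false) (hy : S y false false false true)
    (hz : S z false false false true) : ¬G.Adj y z := by
  intro hyz
  have hxy := ((hP.of_sees_ab hG (x := x) (y := y) (by rintro rfl; simp_all [Sees]) hx).2.2.2.2.1 hy)
  have hxz := ((hP.of_sees_ab hG (x := x) (y := z) (by rintro rfl; simp_all [Sees]) hx).2.2.2.2.1 hz)
  obtain ⟨hab, hac, hbc, hcd, had, hbd⟩ := hP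
  have h1 := hG.not_graph6_7 x y z c a d
  simp_all [Sees, G.adj_comm]

theorem not_adj_of_sees_cd_d_d (hP : IsPaw G a b c d) (hG : IsFOddHolesFree G) {x y z : V}
    (hx : S x false false true true) (hy : S y false false false true)
    (hz : S z false false false true) : ¬G.Adj y z := by
  intro hyz
  have hxy := ((hP.of_sees_cd hG (x := x) (y := y) (by rintro rfl; simp_all [Sees]) hx).2 hy)
  have hxz := ((hP.of_sees_cd hG (x := x) (y := z) (by rintro rfl; simp_all [Sees]) hx).2 hz)
  obtain ⟨hab, hac, hbc, hcd, had, hbd⟩ := hP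
  have h1 := hG.not_fullHouse c y z d x
  simp_all [Sees, G.adj_comm]

/-- Otherwise `d` and `x` are both joined to `c`, `y`, `z`; with the triangle `a b c` this is
`graph6_15`. -/
theorem adj_of_sees_c_d_d (hP : IsPaw G a b c d) (hG : IsFOddHolesFree G) {x y z : V}
    (hyz : y ≠ z) (hx : S x false false true false) (hy : S y false false false true)
    (hz : S z false false false true) : G.Adj y z := by
  by_contra hadj
  have hxy := ((hP.of_sees_c hG (x := x) (y := y) (by rintro rfl; simp_all [Sees]) hx).2.2 hy)
  have hxz := ((hP.of_sees_c hG (x := x) (y := z) (by rintro rfl; simp_all [Sees]) hx).2.2 hz)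
  obtain ⟨hab, hac, hbc, hcd, had, hbd⟩ := hP
  have h1 := hG.not_graph6_15 a b y z d x c
  simp_all [Sees, G.adj_comm]

/-- One edge inside kind `d` makes the whole kind a clique: `z` missing both ends gives `graph6_5`,
and missing only `y` gives a dart. -/
theorem adj_of_sees_d_d_d (hP : IsPaw G a b c d) (hG : IsFOddHolesFree G) {x y z : V}
    (hyz : y ≠ z) (hxz : x ≠ z) (hx : S x false false false true)
    (hy : S y false false false true) (hz : S z false false false true) (hxy : G.Adj x y) :
    G.Adj y z := by
  by_contra hadj
  obtain ⟨hab, hac, hbc, hcd, had, hbd⟩ := hP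
  have h1 := hG.not_graph6_5 a z x y c d
  have h2 := hG.not_dart c y z x d
  by_cases h : G.Adj x z <;> simp_all [Sees, G.adj_comm]

theorem eq_or_seesPaw (hP : IsPaw G a b c d) (hG : IsFOddHolesFree G) (hc : G.Connected) (x : V) :
    x = a ∨ x = b ∨ x = c ∨ x = d ∨ SeesPaw G a b c d x := by
  obtain ⟨w⟩ := hc.preconnected a x
  suffices H : ∀ u v : V, G.Walk u v → u = a →
      v = a ∨ v = b ∨ v = c ∨ v = d ∨ SeesPaw G a b c d v from H a x w rfl
  intro u v w hu
  induction w using SimpleGraph.Walk.concatRec with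
  | Hnil => exact Or.inl hu
  | @Hconcat u v v' p h ih =>
    by_cases hne : v' ≠ a ∧ v' ≠ b ∧ v' ≠ c ∧ v' ≠ d
    · by_cases hadj : G.Adj a v' ∨ G.Adj b v' ∨ G.Adj c v' ∨ G.Adj d v'
      · have := hP.sees_of_adj hG hne hadj
        tauto
      · exfalso
        have hv' : S v' false false false false := by simp_all [Sees]
        rcases ih hu with rfl | rfl | rfl | rfl | ih
        · exact hadj (Or.inl h)
        · exact hadj (Or.inr (Or.inl h))
        · exact hadj (Or.inr (Or.inr (Or.inl h)))
        · exact hadj (Or.inr (Or.inr (Or.inr h)))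
        · exact hP.not_adj_of_sees_none hG hv' ih h.symm
    · tauto

end IsPaw
end Paw

/-! ### Embedding into path blow-ups -/

/-- Every class has room for a numbering of all of `V`, so one global numbering supplies the second
coordinates and gives injectivity whatever `f` is. -/
theorem isIndContained_pathBlowup {V : Type*} [Fintype V] {G : SimpleGraph V} {k : ℕ}
    (a : Fin k → ℤ) (ha : ∀ i, Fintype.card V ≤ (a i).natAbs) (f : V → Fin k)
    (hf : ∀ x y, x ≠ y → (G.Adj x y ↔
      (SimpleGraph.pathGraph k).Adj (f x) (f y) ∨ (f x = f y ∧ 0 < a (f x)))) :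
    G ⊴ pathBlowup a := by
  refine ⟨⟨⟨fun x => ⟨f x, ⟨Fintype.equivFin V x, ?_⟩⟩, fun x y hxy => ?_⟩, fun {x y} => ?_⟩⟩
  · have := ha (f x)
    have := (Fintype.equivFin V x).2
    omega
  · simp only [Sigma.mk.injEq] at hxy
    obtain ⟨h1, h2⟩ := hxy
    have h3 : (Fintype.equivFin V x : ℕ) = Fintype.equivFin V y := by
      have : ∀ i j : Fin k, i = j → ∀ (u : Fin ((a i).natAbs + 1)) (v : Fin ((a j).natAbs + 1)),
          HEq u v → (u : ℕ) = v := by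
        rintro i _ rfl u v h
        rw [eq_of_heq h]
      exact this _ _ h1 _ _ h2
    exact (Fintype.equivFin V).injective (Fin.ext h3)
  · by_cases hxy : x = y
    · subst hxy
      simp
    · refine Iff.trans ?_ (hf x y hxy).symm
      change (SimpleGraph.pathGraph k).Adj (f x) (f y) ∨ (f x = f y ∧ 0 < a (f x) ∧ _) ↔ _
      refine or_congr Iff.rfl (and_congr_right fun h => and_iff_left fun he => hxy ?_)
      have h3 : (Fintype.equivFin V x : ℕ) = Fintype.equivFin V y := congrArg (fun z : (Σ i : Fin k, Fin ((a i).natAbs + 1)) => (z.2 : ℕ)) he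
      exact (Fintype.equivFin V).injective (Fin.ext h3)

section
variable {V : Type*} {G : SimpleGraph V}
namespace IsPaw

variable {a b c d : V}

local notation "S" => Sees G a b c d

/-- If the vertices of a paw and of its six kinds of neighbours carry labels that describe the
adjacencies to the paw and between those neighbours, then they describe all adjacencies. -/
theorem adj_iff_of_label (hP : IsPaw G a b c d) {k : ℕ} (R : Fin k → Fin k → Bool)
    (hsymm : ∀ i j, R i j = R j i) (p q r : Fin k) (hpp : R p p) (hpq : R p q) (hqr : R q r)
    (hpr : R p r = false) (f : V → Fin k)
    (hf : ∀ x, (x = a ∧ f x = p) ∨ (x = b ∧ f x = p) ∨ (x = c ∧ f x = q) ∨ (x = d ∧ f x = r) ∨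
      S x (R p (f x)) (R p (f x)) (R q (f x)) (R r (f x)))
    (h : ∀ x y i j, x ≠ y → i ≤ j → S x (R p i) (R p i) (R q i) (R r i) →
      S y (R p j) (R p j) (R q j) (R r j) → (G.Adj x y ↔ R i j))
    {x y : V} (hxy : x ≠ y) : G.Adj x y ↔ R (f x) (f y) := by
  have hqp := hsymm q p
  have hrq := hsymm r q
  have hrp := hsymm r p
  have hab := hP.ab
  have hac := hP.ac
  have hbc := hP.bc
  have hcd := hP.cd
  have had := hP.not_ad
  have hbd := hP.not_bd
  rcases hf x with ⟨rfl, hx⟩ | ⟨rfl, hx⟩ | ⟨rfl, hx⟩ | ⟨rfl, hx⟩ | hx <;>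
  rcases hf y with ⟨rfl, hy⟩ | ⟨rfl, hy⟩ | ⟨rfl, hy⟩ | ⟨rfl, hy⟩ | hy
  -- Both vertices lie outside the paw: the only case that needs `h`. Symmetry of `R` allows the
  -- labels to be ordered.
  case inr.inr.inr.inr.inr.inr.inr.inr =>
    rcases le_total (f x) (f y) with hle | hle
    · exact h x y _ _ hxy hle hx hy
    · rw [G.adj_comm, hsymm]
      exact h y x _ _ hxy.symm hle hy hx
  all_goals clear h hf
  case inl.inr.inr.inr.inr => rw [hx]; exact hy.2.1
  case inr.inl.inr.inr.inr.inr => rw [hx]; exact hy.2.2.1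
  case inr.inr.inl.inr.inr.inr.inr => rw [hx]; exact hy.2.2.2.1
  case inr.inr.inr.inl.inr.inr.inr.inr => rw [hx]; exact hy.2.2.2.2
  case inr.inr.inr.inr.inl => rw [hy, G.adj_comm, hsymm]; exact hx.2.1
  case inr.inr.inr.inr.inr.inl => rw [hy, G.adj_comm, hsymm]; exact hx.2.2.1
  case inr.inr.inr.inr.inr.inr.inl => rw [hy, G.adj_comm, hsymm]; exact hx.2.2.2.1
  case inr.inr.inr.inr.inr.inr.inr.inl => rw [hy, G.adj_comm, hsymm]; exact hx.2.2.2.2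
  all_goals simp_all [G.adj_comm]

theorem isIndContained_pathBlowup_five [Fintype V] (hP : IsPaw G a b c d) (hG : IsFOddHolesFree G)
    (hc : G.Connected) (h1 : ∀ x, ¬S x false false true false)
    (h2 : ∀ x y, S x false false false true → S y false false false true → ¬G.Adj x y) :
    ∃ m₁ n₁ m₂ n₂ m₃ : ℕ,
      G ⊴ pathBlowup ![-(m₁ : ℤ), (n₁ : ℤ), -(m₂ : ℤ), (n₂ : ℤ), -(m₃ : ℤ)] := by
  -- All class parameters will be `Fintype.card V`; a class is a clique only if its parameter is
  -- strictly positive.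
  have hN : 0 < Fintype.card V := Fintype.card_pos_iff.2 ⟨a⟩
  let R : Fin 5 → Fin 5 → Bool := fun i j =>
    decide (i.val + 1 = j.val ∨ j.val + 1 = i.val ∨ (i = j ∧ (i = 1 ∨ i = 3)))
  have hlabel : ∀ x, ∃ i : Fin 5, (x = a ∧ i = 1) ∨ (x = b ∧ i = 1) ∨ (x = c ∧ i = 2) ∨
      (x = d ∧ i = 3) ∨ S x (R 1 i) (R 1 i) (R 2 i) (R 3 i) := by
    intro x
    rcases hP.eq_or_seesPaw hG hc x with h | h | h | h | h | h | h | h | h | h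
    · exact ⟨1, by simp [h]⟩
    · exact ⟨1, by simp [h]⟩
    · exact ⟨2, by simp [h]⟩
    · exact ⟨3, by simp [h]⟩
    · exact ⟨0, by simp [R, h]⟩
    · exact ⟨1, by simp [R, h]⟩
    · exact ⟨2, by simp [R, h]⟩
    · exact absurd h (h1 x)
    · exact ⟨3, by simp [R, h]⟩
    · exact ⟨4, by simp [R, h]⟩
  choose f hf using hlabel
  refine ⟨Fintype.card V, Fintype.card V, Fintype.card V, Fintype.card V, Fintype.card V,
    _root_.isIndContained_pathBlowup _ (by simp [Fin.forall_fin_succ]) f fun x y hxy => ?_⟩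
  rw [hP.adj_iff_of_label R (by decide) 1 2 3 rfl rfl rfl rfl f hf ?_ hxy, SimpleGraph.pathGraph_adj]
  · generalize f x = i
    generalize f y = j
    fin_cases i <;> fin_cases j <;> simp [R, hN]
  · intro x y i j hxy hij hx hy
    have k1 := hP.of_sees_ab hG hxy
    have k2 := hP.of_sees_abc hG hxy
    have k3 := hP.of_sees_abd hG hxy
    have k4 := hP.of_sees_cd hG hxy
    fin_cases i <;> fin_cases j <;> first | exact absurd hij (by decide) | skip
    · exact iff_of_false ((k1 hx).1 hy) (by decide)
    · exact iff_of_true ((k1 hx).2.1 hy) (by decide)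
    · exact iff_of_false ((k1 hx).2.2.1 hy) (by decide)
    · exact iff_of_false ((k1 hx).2.2.2.1 hy) (by decide)
    · exact iff_of_false ((k1 hx).2.2.2.2.1 hy) (by decide)
    · exact iff_of_true ((k2 hx).1 hy) (by decide)
    · exact iff_of_true ((k2 hx).2.1 hy) (by decide)
    · exact iff_of_false ((k2 hx).2.2.1 hy) (by decide)
    · exact iff_of_false ((k2 hx).2.2.2.1 hy) (by decide)
    · exact iff_of_false ((k3 hx).1 hy) (by decide)
    · exact iff_of_true ((k3 hx).2.1 hy) (by decide)
    · exact iff_of_false ((k3 hx).2.2.1 hy) (by decide)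
    · exact iff_of_true ((k4 hx).1 hy) (by decide)
    · exact iff_of_true ((k4 hx).2 hy) (by decide)
    · exact iff_of_false (h2 x y hx hy) (by decide)

theorem isIndContained_pathBlowup_four [Fintype V] (hP : IsPaw G a b c d) (hG : IsFOddHolesFree G)
    (hc : G.Connected) (h1 : ∀ x, ¬S x true true false false) (h2 : ∀ x, ¬S x false false true true)
    (h3 : ∀ x y, x ≠ y → S x false false false true → S y false false false true → G.Adj x y) :
    ∃ n₁ m₁ m₂ n₂ : ℕ, G ⊴ pathBlowup ![(n₁ : ℤ), -(m₁ : ℤ), -(m₂ : ℤ), (n₂ : ℤ)] := by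
  have hN : 0 < Fintype.card V := Fintype.card_pos_iff.2 ⟨a⟩
  let R : Fin 4 → Fin 4 → Bool := fun i j =>
    decide (i.val + 1 = j.val ∨ j.val + 1 = i.val ∨ (i = j ∧ (i = 0 ∨ i = 3)))
  have hlabel : ∀ x, ∃ i : Fin 4, (x = a ∧ i = 0) ∨ (x = b ∧ i = 0) ∨ (x = c ∧ i = 1) ∨
      (x = d ∧ i = 2) ∨ S x (R 0 i) (R 0 i) (R 1 i) (R 2 i) := by
    intro x
    rcases hP.eq_or_seesPaw hG hc x with h | h | h | h | h | h | h | h | h | h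
    · exact ⟨0, by simp [h]⟩
    · exact ⟨0, by simp [h]⟩
    · exact ⟨1, by simp [h]⟩
    · exact ⟨2, by simp [h]⟩
    · exact absurd h (h1 x)
    · exact ⟨0, by simp [R, h]⟩
    · exact ⟨1, by simp [R, h]⟩
    · exact ⟨2, by simp [R, h]⟩
    · exact absurd h (h2 x)
    · exact ⟨3, by simp [R, h]⟩
  choose f hf using hlabel
  refine ⟨Fintype.card V, Fintype.card V, Fintype.card V, Fintype.card V,
    _root_.isIndContained_pathBlowup _ (by simp [Fin.forall_fin_succ]) f fun x y hxy => ?_⟩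
  rw [hP.adj_iff_of_label R (by decide) 0 1 2 rfl rfl rfl rfl f hf ?_ hxy, SimpleGraph.pathGraph_adj]
  · generalize f x = i
    generalize f y = j
    fin_cases i <;> fin_cases j <;> simp [R, hN]
  · intro x y i j hxy hij hx hy
    have k1 := hP.of_sees_abc hG hxy
    have k2 := hP.of_sees_abd hG hxy
    have k3 := hP.of_sees_c hG hxy
    fin_cases i <;> fin_cases j <;> first | exact absurd hij (by decide) | skip
    · exact iff_of_true ((k1 hx).1 hy) (by decide)
    · exact iff_of_true ((k1 hx).2.1 hy) (by decide)
    · exact iff_of_false ((k1 hx).2.2.2.2 hy) (by decide)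
    · exact iff_of_false ((k1 hx).2.2.2.1 hy) (by decide)
    · exact iff_of_false ((k2 hx).1 hy) (by decide)
    · exact iff_of_true ((k2 hx).2.2.2 hy) (by decide)
    · exact iff_of_false ((k2 hx).2.2.1 hy) (by decide)
    · exact iff_of_false ((k3 hx).1 hy) (by decide)
    · exact iff_of_true ((k3 hx).2.2 hy) (by decide)
    · exact iff_of_true (h3 x y hxy hx hy) (by decide)

/-- Kind `ab` or `cd` forces the `P_5` shape. Without them, an edge inside kind `d` or a vertex of
kind `c` leads to `P_4`; if neither occurs, `P_5` fits. -/
theorem isIndContained_pathBlowup [Fintype V] (hP : IsPaw G a b c d) (hG : IsFOddHolesFree G)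
    (hc : G.Connected) :
    (∃ m₁ n₁ m₂ n₂ m₃ : ℕ,
      G ⊴ pathBlowup ![-(m₁ : ℤ), (n₁ : ℤ), -(m₂ : ℤ), (n₂ : ℤ), -(m₃ : ℤ)]) ∨
    (∃ n₁ m₁ m₂ n₂ : ℕ,
      G ⊴ pathBlowup ![(n₁ : ℤ), -(m₁ : ℤ), -(m₂ : ℤ), (n₂ : ℤ)]) := by
  by_cases h : (∃ x, S x true true false false) ∨ ∃ x, S x false false true true
  · left
    refine hP.isIndContained_pathBlowup_five hG hc (fun y hy => ?_) fun y z hy hz => ?_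
    · rcases h with ⟨x, hx⟩ | ⟨x, hx⟩
      · exact (hP.of_sees_ab hG (by rintro rfl; simp_all [Sees]) hx).2.2.2.2.2 hy
      · exact (hP.of_sees_c hG (by rintro rfl; simp_all [Sees]) hy).2.1 hx
    · rcases h with ⟨x, hx⟩ | ⟨x, hx⟩
      · exact hP.not_adj_of_sees_ab_d_d hG hx hy hz
      · exact hP.not_adj_of_sees_cd_d_d hG hx hy hz
  simp only [not_or, not_exists] at h
  by_cases hd : ∃ x y, S x false false false true ∧ S y false false false true ∧ G.Adj x y
  · right
    obtain ⟨x, y, hx, hy, hxy⟩ := hd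
    refine hP.isIndContained_pathBlowup_four hG hc h.1 h.2 fun u v huv hu hv => ?_
    have key : ∀ w, S w false false false true → w ≠ x → G.Adj x w := fun w hw hwx => by
      by_cases hwy : y = w
      · exact hwy ▸ hxy
      · exact hP.adj_of_sees_d_d_d hG (Ne.symm hwx) hwy hy hx hw hxy.symm
    by_cases hux : u = x
    · exact hux ▸ key v hv (hux ▸ huv.symm)
    by_cases hvx : v = x
    · exact hvx ▸ (key u hu hux).symm
    exact hP.adj_of_sees_d_d_d hG huv (Ne.symm hvx) hx hu hv (key u hu hux)
  push Not at hd
  by_cases hcx : ∃ x, S x false false true false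
  · right
    obtain ⟨x, hx⟩ := hcx
    exact hP.isIndContained_pathBlowup_four hG hc h.1 h.2 fun u v huv hu hv =>
      hP.adj_of_sees_c_d_d hG huv hx hu hv
  · left
    push Not at hcx
    exact hP.isIndContained_pathBlowup_five hG hc hcx hd

end IsPaw
end

/-! ### Induced odd cycles in non-bipartite graphs -/

namespace SimpleGraph
variable {V : Type*} {G : SimpleGraph V}

/-- A graph that is not bipartite has an induced cycle of odd length at least three. -/
theorem exists_odd_cycleGraph_isIndContained (h : ¬G.IsBipartite) :
    ∃ n, Odd n ∧ 3 ≤ n ∧ cycleGraph n ⊴ G := by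
  classical
  have hex : ∃ n, Odd n ∧ ∃ u, ∃ w : G.Walk u u, w.length = n := by
    rw [IsBipartite, two_colorable_iff_forall_loop_even] at h
    push Not at h
    obtain ⟨u, w, hw⟩ := h
    exact ⟨w.length, Nat.not_even_iff_odd.1 hw, u, w, rfl⟩
  obtain ⟨hodd, u, w, hw⟩ := Nat.find_spec hex
  have hmin : ∀ u (w : G.Walk u u), Odd w.length → Nat.find hex ≤ w.length :=
    fun u w hw => Nat.find_min' hex ⟨hw, u, w, rfl⟩
  generalize Nat.find hex = n at *
  have hseg : ∀ i k, i + k ≤ n → ∃ q : G.Walk (w.getVert i) (w.getVert (i + k)), q.length = k := by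
    intro i k
    induction k with
    | zero => exact fun _ => ⟨Walk.nil, rfl⟩
    | succ k ih =>
      intro hk
      obtain ⟨q, hq⟩ := ih (by omega)
      exact ⟨q.concat (w.adj_getVert_succ (by omega)), by simp [hq]⟩
  have hends : w.getVert n = w.getVert 0 := by simp [← hw]
  -- The complementary arc, through the base point of the closed walk.
  have hback : ∀ i k, i + k ≤ n →
      ∃ q : G.Walk (w.getVert (i + k)) (w.getVert i), q.length = n - k := by
    intro i k hk
    obtain ⟨q₁, h₁⟩ := hseg (i + k) (n - (i + k)) (by omega)
    obtain ⟨q₂, h₂⟩ := hseg 0 i (by omega)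
    have e₁ : w.getVert (i + k + (n - (i + k))) = w.getVert 0 := by
      rw [show i + k + (n - (i + k)) = n by omega, hends]
    have e₂ : w.getVert (0 + i) = w.getVert i := by rw [zero_add]
    exact ⟨(q₁.copy rfl e₁).append (q₂.copy rfl e₂), by simp [h₁, h₂]; omega⟩
  have hn1 : n ≠ 1 := by
    rintro rfl
    have := w.adj_getVert_succ (i := 0) (by omega)
    rw [zero_add, hends] at this
    exact this.ne rfl
  -- A repeated vertex splits the walk into closed walks of lengths `k` and `n - k`; one is odd and
  -- shorter.
  have hinj : ∀ i k, i + k < n → 0 < k → w.getVert i ≠ w.getVert (i + k) := by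
    intro i k hk h0 he
    obtain ⟨q₁, h₁⟩ := hseg i k hk.le
    obtain ⟨q₂, h₂⟩ := hback i k hk.le
    rcases Nat.even_or_odd k with hk' | hk'
    · have := hmin _ (q₂.copy he.symm rfl) (by simpa [h₂] using Nat.Odd.sub_even (by omega) hodd hk')
      simp [h₂] at this
      omega
    · have := hmin _ (q₁.copy rfl he.symm) (by simpa [h₁] using hk')
      simp [h₁] at this
      omega
  -- A chord closes the two arcs to lengths `k + 1` and `n - k + 1`; the odd one is shorter than `n`
  -- unless the chord is an edge of the walk.
  have hchord : ∀ i k, i + k < n → 0 < k → G.Adj (w.getVert i) (w.getVert (i + k)) →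
      k = 1 ∨ k = n - 1 := by
    intro i k hk h0 hadj
    obtain ⟨q₁, h₁⟩ := hseg i k hk.le
    obtain ⟨q₂, h₂⟩ := hback i k hk.le
    by_contra hcon
    rcases Nat.even_or_odd k with hk' | hk'
    · have := hmin _ (q₁.concat hadj.symm) (by simpa [h₁] using hk'.add_one)
      simp [h₁] at this
      omega
    · have := hmin _ (q₂.concat hadj)
        (by simpa [h₂] using (Nat.Odd.sub_odd hodd hk').add_one)
      simp [h₂] at this
      omega
  have hn3 : 3 ≤ n := by
    obtain ⟨m, rfl⟩ := hodd
    omega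
  have hadj : ∀ i k, i + k < n → 0 < k →
      (G.Adj (w.getVert i) (w.getVert (i + k)) ↔ k = 1 ∨ k = n - 1) := by
    refine fun i k hk h0 => ⟨hchord i k hk h0, ?_⟩
    rintro (rfl | rfl)
    · exact w.adj_getVert_succ (by omega)
    · obtain rfl : i = 0 := by omega
      have := w.adj_getVert_succ (i := n - 1) (by omega)
      rw [show n - 1 + 1 = n by omega, hends] at this
      simpa using this.symm
  have hlt : ∀ i j : Fin n, i < j → w.getVert i ≠ w.getVert j ∧
      (G.Adj (w.getVert i) (w.getVert j) ↔ (cycleGraph n).Adj i j) := by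
    intro i j hij
    obtain ⟨k, hk⟩ := Nat.exists_eq_add_of_le (Fin.lt_def.1 hij).le
    have hj := j.2
    have hij' := Fin.lt_def.1 hij
    rw [hk]
    refine ⟨hinj i k (by omega) (by omega), ?_⟩
    rw [hadj i k (by omega) (by omega), cycleGraph_adj', Fin.coe_sub_iff_lt.2 hij,
      Fin.coe_sub_iff_le.2 hij.le]
    omega
  refine ⟨n, hodd, hn3, ⟨⟨⟨fun i => w.getVert i, fun i j he => ?_⟩, fun {i j} => ?_⟩⟩⟩
  · by_contra hne
    rcases lt_or_gt_of_ne hne with h | h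
    · exact (hlt i j h).1 he
    · exact (hlt j i h).1 he.symm
  · change G.Adj (w.getVert i) (w.getVert j) ↔ _
    rcases lt_trichotomy i j with h | rfl | h
    · exact (hlt i j h).2
    · simp
    · rw [G.adj_comm, (hlt j i h).2, SimpleGraph.adj_comm]

end SimpleGraph

/-! ### Induced five-cycles -/

section Cycle

variable {V : Type*} {G : SimpleGraph V}

/-- Each of the sixteen neighbourhoods on the cycle that contain `a` produces one of the patterns
listed. -/
theorem IsFOddHolesFree.not_adj_of_five_cycle (hG : IsFOddHolesFree G) {a b c d e x : V}
    (hab : G.Adj a b) (hbc : G.Adj b c) (hcd : G.Adj c d) (hde : G.Adj d e) (hae : G.Adj a e)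
    (hac : ¬G.Adj a c) (had : ¬G.Adj a d) (hbd : ¬G.Adj b d) (hbe : ¬G.Adj b e)
    (hce : ¬G.Adj c e) (hx : x ≠ a ∧ x ≠ b ∧ x ≠ c ∧ x ≠ d ∧ x ≠ e) : ¬G.Adj a x := by
  intro hax
  have h1 := hG.not_fivePan x c d e b a
  have h2 := hG.not_bull c e x a b
  have h3 := hG.not_graph6_10 d e b x a c
  have h4 := hG.not_coTwinC5 d e b x a c
  have h5 := hG.not_graph6_10 b c e x d a
  have h6 := hG.not_bull b e x d c
  have h7 := hG.not_house a e c d x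
  have h8 := hG.not_bull b d x e a
  have h9 := hG.not_coTwinC5 c d a x e b
  have h10 := hG.not_house c d a e x
  have h11 := hG.not_coTwinC5 b c e x d a
  have h12 := hG.not_house b c e d x
  have h13 := hG.not_house a b d c x
  have h14 := hG.not_gem a c d e x
  by_cases hb : G.Adj b x <;> by_cases hc : G.Adj c x <;> by_cases hd : G.Adj d x <;>
    by_cases he : G.Adj e x <;> simp_all [G.adj_comm]

/-- A connected `F`-free graph with an induced five-cycle is the five-cycle. -/
theorem IsFOddHolesFree.nonempty_iso_cycleGraph_five (hG : IsFOddHolesFree G) (hc : G.Connected)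
    (h : SimpleGraph.cycleGraph 5 ⊴ G) : Nonempty (G ≃g SimpleGraph.cycleGraph 5) := by
  obtain ⟨f⟩ := h
  have hadj : ∀ i j, G.Adj (f i) (f j) ↔ (SimpleGraph.cycleGraph 5).Adj i j :=
    fun i j => f.map_adj_iff
  have hsurj : Function.Surjective f := by
    by_contra hcon
    simp only [Function.Surjective, not_forall] at hcon
    obtain ⟨v, hv⟩ := hcon
    obtain ⟨w⟩ := hc.preconnected (f 0) v
    obtain ⟨⟨⟨y, x⟩, hyx⟩, -, ⟨i, rfl⟩, hx⟩ :=
      w.exists_boundary_dart (Set.range f) ⟨0, rfl⟩ hv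
    have hne : ∀ j, x ≠ f j := fun j hj => hx ⟨j, hj.symm⟩
    -- An edge leaves the cycle at `f i`; addition in `Fin 5` rotates the cycle to start there.
    refine hG.not_adj_of_five_cycle (a := f i) (b := f (i + 1)) (c := f (i + 2)) (d := f (i + 3))
      (e := f (i + 4)) ?_ ?_ ?_ ?_ ?_ ?_ ?_ ?_ ?_ ?_
      ⟨hne _, hne _, hne _, hne _, hne _⟩ hyx <;> rw [hadj] <;> clear hx hyx <;> revert i <;>
      simp only [SimpleGraph.cycleGraph_adj'] <;> decide
  exact ⟨(RelIso.ofSurjective f hsurj).symm⟩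

end Cycle

/-! ### Triangles without induced paws -/

section Multipartite

variable {V : Type*} {G : SimpleGraph V}

theorem isCompleteMultipartite_of_forall_not_isPaw (hc : G.Connected)
    (hP : ∀ a b c d, ¬IsPaw G a b c d) {a b c : V} (hab : G.Adj a b) (hac : G.Adj a c)
    (hbc : G.Adj b c) : G.IsCompleteMultipartite := by
  -- Every vertex sees two vertices of each triangle. Otherwise some edge `u v` leaves the set of
  -- vertices that do; with no paw on `a b c`, `v` sees none of the three, and then `u`, two
  -- triangle vertices it sees, and `v` form a paw.
  have hdom : ∀ a b c : V, G.Adj a b → G.Adj a c → G.Adj b c → ∀ z,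
      (G.Adj a z ∧ G.Adj b z) ∨ (G.Adj a z ∧ G.Adj c z) ∨ (G.Adj b z ∧ G.Adj c z) := by
    intro a b c hab hac hbc z
    by_contra hz
    obtain ⟨w⟩ := hc.preconnected a z
    obtain ⟨⟨⟨u, v⟩, huv⟩, -, hu, hv⟩ := w.exists_boundary_dart
      {z | (G.Adj a z ∧ G.Adj b z) ∨ (G.Adj a z ∧ G.Adj c z) ∨ (G.Adj b z ∧ G.Adj c z)}
      (Or.inr (Or.inr ⟨hab.symm, hac.symm⟩)) hz
    simp only [Set.mem_ofPred_eq] at hu hv huv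
    have ha : ¬G.Adj a v := fun h => hP b c a v
      ⟨hbc, hab.symm, hac.symm, h, fun h' => hv (Or.inl ⟨h, h'⟩),
        fun h' => hv (Or.inr (Or.inl ⟨h, h'⟩))⟩
    have hb : ¬G.Adj b v := fun h => hP a c b v
      ⟨hac, hab, hbc.symm, h, ha, fun h' => hv (Or.inr (Or.inr ⟨h, h'⟩))⟩
    have hc' : ¬G.Adj c v := fun h => hP a b c v ⟨hab, hac, hbc, h, ha, hb⟩
    rcases hu with ⟨h, h'⟩ | ⟨h, h'⟩ | ⟨h, h'⟩
    · exact hP a b u v ⟨hab, h, h', huv, ha, hb⟩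
    · exact hP a c u v ⟨hac, h, h', huv, ha, hc'⟩
    · exact hP b c u v ⟨hbc, h, h', huv, hb, hc'⟩
  refine ⟨fun x y z hxy hyz hxz => ?_⟩
  -- Two pairs in a triangle intersect, so `x` and `z` have a common neighbour `w`; `y` must then
  -- see `x` or `z`.
  obtain ⟨w, hxw, hzw⟩ : ∃ w, G.Adj x w ∧ G.Adj z w := by
    rcases hdom a b c hab hac hbc x with h | h | h <;>
    rcases hdom a b c hab hac hbc z with h' | h' | h'
    all_goals first
      | exact ⟨_, h.1.symm, h'.1.symm⟩
      | exact ⟨_, h.1.symm, h'.2.symm⟩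
      | exact ⟨_, h.2.symm, h'.1.symm⟩
      | exact ⟨_, h.2.symm, h'.2.symm⟩
  rcases hdom x z w hxz hxw hzw y with h | h | h
  · exact hxy h.1
  · exact hxy h.1
  · exact hyz h.1.symm

theorem nonempty_iso_completeMultipartiteOfSizes [Fintype V] {p : ℕ} (s : Fin p → ℕ)
    (f : V → Fin p) (hs : ∀ i, Fintype.card {x // f x = i} = s i)
    (hf : ∀ x y, G.Adj x y ↔ f x ≠ f y) : Nonempty (G ≃g completeMultipartiteOfSizes s) := by
  let e : (Σ i, {x // f x = i}) ≃ Σ i, Fin (s i) :=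
    Equiv.sigmaCongrRight fun i => Fintype.equivFinOfCardEq (hs i)
  refine ⟨⟨(Equiv.sigmaFiberEquiv f).symm.trans e, fun {x y} => ?_⟩⟩
  rw [hf]
  rfl

/-- A connected complete multipartite graph without `K_{2,2,1,1}` that contains a triangle. -/
theorem IsFOddHolesFree.of_isCompleteMultipartite [Fintype V] (hG : IsFOddHolesFree G)
    (hM : G.IsCompleteMultipartite) {a b c : V} (hab : G.Adj a b) (hac : G.Adj a c)
    (hbc : G.Adj b c) :
    (∃ a b c : ℕ, 1 ≤ a ∧ 1 ≤ b ∧ 1 ≤ c ∧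
      Nonempty (G ≃g completeMultipartiteOfSizes ![a, b, c])) ∨
    (∃ p : ℕ, 1 ≤ p ∧ p ≤ Fintype.card V ∧
      Nonempty (G ≃g completeMultipartiteOfSizes
        (fun i : Fin p => if (i : ℕ) = 0 then Fintype.card V - p + 1 else 1))) := by
  classical
  have htrans : ∀ x y z, ¬G.Adj x y → ¬G.Adj y z → ¬G.Adj x z := fun x y z => hM.trans x y z
  by_cases hd : ∃ d, G.Adj a d ∧ G.Adj b d ∧ G.Adj c d
  · right
    obtain ⟨d, had, hbd, hcd⟩ := hd
    -- At most one part is not a singleton: `x` and `y` each miss at most one vertex of the `K_4`,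
    -- so two of its vertices see both and would complete `K_{2,2,1,1}`.
    have hpart : ∀ x x' y y', x ≠ x' → y ≠ y' → ¬G.Adj x x' → ¬G.Adj y y' → ¬G.Adj x y := by
      intro x x' y y' hx hy hxx hyy hxy
      have key : ∀ u v, G.Adj u v → G.Adj x u → G.Adj x v → G.Adj y u → G.Adj y v → False := by
        intro u v huv hxu hxv hyu hyv
        have := hG.not_graph6_14 x x' y y' u v
        grind [G.adj_comm]
      have hex : ∀ u v, G.Adj u v → (G.Adj x u ∨ G.Adj x v) ∧ (G.Adj y u ∨ G.Adj y v) := by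
        intro u v huv
        grind [G.adj_comm]
      have h1 := hex _ _ hab
      have h2 := hex _ _ hac
      have h3 := hex _ _ hbc
      have h4 := hex _ _ had
      have h5 := hex _ _ hbd
      have h6 := hex _ _ hcd
      have k1 := key _ _ hab
      have k2 := key _ _ hac
      have k3 := key _ _ hbc
      have k4 := key _ _ had
      have k5 := key _ _ hbd
      have k6 := key _ _ hcd
      clear key hex
      grind
    -- Choose `o` in the large part if there is one. Its non-neighbours form part `0` and each
    -- neighbour is a part of its own, so `p` is the degree of `o` plus one.
    obtain ⟨o, ho⟩ : ∃ o, ∀ x y, G.Adj o x → G.Adj o y → x ≠ y → G.Adj x y := by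
      by_cases h : ∃ o o', o ≠ o' ∧ ¬G.Adj o o'
      · obtain ⟨o, o', hne, hoo⟩ := h
        exact ⟨o, fun x y hx _ hxy => by_contra fun h' => hpart o o' x y hne hxy hoo h' hx⟩
      · push Not at h
        exact ⟨a, fun x y _ _ hxy => h x y hxy⟩
    have hcard : Fintype.card {x // G.Adj o x} < Fintype.card V :=
      Fintype.card_subtype_lt (x := o) (G.loopless.irrefl o)
    refine ⟨Fintype.card {x // G.Adj o x} + 1, by omega, by omega, ?_⟩
    let e := Fintype.equivFin {x // G.Adj o x}
    let f : V → Fin (Fintype.card {x // G.Adj o x} + 1) :=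
      fun x => if h : G.Adj o x then (e ⟨x, h⟩).succ else 0
    have hf0 : ∀ x, f x = 0 ↔ ¬G.Adj o x := by
      intro x
      by_cases h : G.Adj o x <;> simp [f, h, Fin.succ_ne_zero]
    refine nonempty_iso_completeMultipartiteOfSizes _ f (fun i => ?_) fun x y => ?_
    · induction i using Fin.cases with
      | zero =>
        simp only [hf0]
        rw [Fintype.card_subtype_compl]
        simp
        omega
      | succ i =>
        simp only [Fin.val_succ, Nat.add_eq_zero_iff, one_ne_zero, and_false, if_false]
        rw [Fintype.card_eq_one_iff]
        refine ⟨⟨e.symm i, by simp [f, (e.symm i).2]⟩, ?_⟩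
        rintro ⟨y, hy⟩
        by_cases h : G.Adj o y
        · simp only [f, h, dite_true, Fin.succ_inj] at hy
          simp [← hy]
        · simp [f, h] at hy
          exact absurd hy.symm (Fin.succ_ne_zero _)
    · by_cases hx : G.Adj o x <;> by_cases hy : G.Adj o y
      · simp only [f, hx, hy, dite_true, ne_eq, Fin.succ_inj, e.injective.eq_iff, Subtype.mk.injEq]
        exact ⟨fun h => h.ne, ho x y hx hy⟩
      · rw [(hf0 y).2 hy]
        exact iff_of_true (by_contra fun h => htrans o y x hy (fun h' => h h'.symm) hx)
          fun h => (hf0 x).1 h hx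
      · rw [(hf0 x).2 hx]
        exact iff_of_true (by_contra fun h => htrans o x y hx h hy) fun h => (hf0 y).1 h.symm hy
      · rw [(hf0 x).2 hx, (hf0 y).2 hy]
        exact iff_of_false (htrans x o y (fun h => hx h.symm) hy) fun h => h rfl
  · left
    push Not at hd
    -- Without a `K_4`, a vertex adjacent to `a` and `b` is not adjacent to `c`, hence lies in the
    -- part of `c`.
    let f : V → Fin 3 := fun x => if ¬G.Adj a x then 0 else if ¬G.Adj b x then 1 else 2
    have hpos : ∀ i, 1 ≤ Fintype.card {x // f x = i} := by
      intro i
      refine Fintype.card_pos_iff.2 ?_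
      fin_cases i
      · exact ⟨a, by simp [f]⟩
      · exact ⟨b, by simp [f, hab]⟩
      · exact ⟨c, by simp [f, hac, hbc]⟩
    refine ⟨_, _, _, hpos 0, hpos 1, hpos 2,
      nonempty_iso_completeMultipartiteOfSizes _ f (by simp [Fin.forall_fin_succ]) fun x y => ?_⟩
    have hx := hd x
    have hy := hd y
    simp only [f]
    grind [G.adj_comm]

end Multipartite

/-! ### The classification -/

theorem mainTheorem2 {V : Type*} [Fintype V] (G : SimpleGraph V) (n : ℕ)
    (hn : Fintype.card V = n) (hconn : G.Connected) (hfree : IsFOddHolesFree G) :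
    Nonempty (G ≃g SimpleGraph.cycleGraph 5) ∨
    G.IsBipartite ∨
    (∃ a b c : ℕ, 1 ≤ a ∧ 1 ≤ b ∧ 1 ≤ c ∧
      Nonempty (G ≃g completeMultipartiteOfSizes ![a, b, c])) ∨
    (∃ p : ℕ, 1 ≤ p ∧ p ≤ n ∧
      Nonempty (G ≃g completeMultipartiteOfSizes
        (fun i : Fin p => if (i : ℕ) = 0 then n - p + 1 else 1))) ∨
    (∃ m₁ n₁ m₂ n₂ m₃ : ℕ,
      G ⊴ pathBlowup ![-(m₁ : ℤ), (n₁ : ℤ), -(m₂ : ℤ), (n₂ : ℤ), -(m₃ : ℤ)]) ∨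
    (∃ n₁ m₁ m₂ n₂ : ℕ,
      G ⊴ pathBlowup ![(n₁ : ℤ), -(m₁ : ℤ), -(m₂ : ℤ), (n₂ : ℤ)]) := by
  subst hn
  by_cases hb : G.IsBipartite
  · exact Or.inr (Or.inl hb)
  obtain ⟨k, hk, hk3, hcyc⟩ := SimpleGraph.exists_odd_cycleGraph_isIndContained hb
  have hk7 : ¬7 ≤ k := fun h => hfree.2 k hk h hcyc
  obtain rfl | rfl : k = 3 ∨ k = 5 := by
    obtain ⟨m, rfl⟩ := hk
    omega
  · obtain ⟨f⟩ := hcyc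
    rw [SimpleGraph.cycleGraph_three_eq_top] at f
    have hab : G.Adj (f 0) (f 1) := f.map_adj_iff.2 (by simp)
    have hac : G.Adj (f 0) (f 2) := f.map_adj_iff.2 (by simp)
    have hbc : G.Adj (f 1) (f 2) := f.map_adj_iff.2 (by simp)
    by_cases hP : ∃ a b c d, IsPaw G a b c d
    · obtain ⟨a, b, c, d, hP⟩ := hP
      exact Or.inr (Or.inr (Or.inr (Or.inr (hP.isIndContained_pathBlowup hfree hconn))))
    · push Not at hP
      rcases hfree.of_isCompleteMultipartite
        (isCompleteMultipartite_of_forall_not_isPaw hconn hP hab hac hbc) hab hac hbc with h | h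
      · exact Or.inr (Or.inr (Or.inl h))
      · exact Or.inr (Or.inr (Or.inr (Or.inl h)))
  · exact Or.inl (hfree.nonempty_iso_cycleGraph_five hconn hcyc)
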